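/- Let $Q_0$ be a probability measure on $\mathbb R$ with $\int e^{\lambda y}\,dQ_0(y)<\infty$ for every real $\lambda$, and let $Q_\lambda$ be the exponential family $dQ_\lambda/dQ_0(y)=e^{\lambda y-\psi(\lambda)}$, where $\psi(\lambda)=\log\int e^{\lambda y}\,dQ_0(y)$. In the functional generalized linear model one observes $n$ independent pairs $(X_i,y_i)$, where $X_i$ is a random element of $L^2[0,1]$ and, given $X_i$, the response $y_i$ has law $Q_{\lambda_i}$ with $\lambda_i=a+\int_0^1 B(t)X_i(t)\,dt$. The parameter $f$ consists of the intercept $a\in\mathbb R$, the law of the covariate $X_i$ (for Gaussian covariates: the mean $\mu$ and the covariance kernel $K$) and the slope $B\in L^2[0,1]$. Write $\mathbb P_{n,f}$ for the law of the observations, and for the expectation under it. Fix real numbers $\alpha>1$, $\beta>1/2$, $R>0$ and a square-integrable kernel $K$ on $[0,1]^2$ with spectral decomposition $K=\sum_{j\ge1}\theta_j\,\phi_j\otimes\phi_j$, where the $\phi_j$ are orthonormal in $L^2[0,1]$ and $\theta_j\asymp j^{-\alpha}$ as $j\to\infty$. Suppose that a centred Gaussian random element of $L^2[0,1]$ with covariance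 kernel $K$ is given, and denote its law by $\nu$. The sub-problem consists of the parameters $f$ with $a=0$, covariate law $\nu$ (so $\mu=0$ and $K$ is fixed) and slope $B=\sum_{j\ge1}b_j\phi_j$ with $|b_j|\le Rj^{-\beta}$ for all $j\ge1$. Put $\rho_n=n^{(1-2\beta)/(\alpha+2\beta)}$. Then there are a constant $c>0$ and an $n_0$, depending only on $Q_0,\alpha,\beta,R$ and the decomposition of $K$, such that for all $n\ge n_0$, every set $\mathcal F$ of parameters that contains the sub-problem (for instance the sub-problem itself), and every estimator $\widehat B$, that is, every measurable map from $(L^2[0,1]\times\mathbb R)^n$ to $L^2[0,1]$, $$\sup_{f\in\mathcal F}\mathbb P_{n,f}\,\|B-\widehat B\|^2\ \ge\ c\,\rho_n ,$$ where $\|\cdot\|$ is the norm of $L^2[0,1]$, $B$ is the slope of $f$, $\widehat B$ is evaluated at the observations, and the value $+\infty$ is allowed on the left. -/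

import Mathlib

open MeasureTheory ProbabilityTheory Filter Set Asymptotics
open scoped ENNReal Topology InnerProductSpace

namespace FunctionalGLM

/-- The real Hilbert space `L²[0,1]`, with Lebesgue measure. -/
abbrev L2I : Type := Lp ℝ 2 (volume.restrict (Icc (0 : ℝ) 1))

/-- `L²[0,1]` carries its Borel sigma-algebra. -/
noncomputable instance instMeasurableSpaceL2I : MeasurableSpace L2I := borel L2I

instance instBorelSpaceL2I : BorelSpace L2I := ⟨rfl⟩

instance instSecondCountableTopologyL2I : SecondCountableTopology L2I :=
  have : Fact ((2 : ℝ≥0∞) ≠ ∞) := ⟨ENNReal.ofNat_ne_top⟩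
  Lp.SecondCountableTopology

/-- The natural exponential family generated by `Q₀`: the kernel `lam ↦ Q_lam` with
`dQ_lam / dQ₀ (y) = exp (lam * y - ψ lam)`, where `ψ lam = log ∫ exp (lam * y) dQ₀(y)`. -/
noncomputable def expFamily (Q₀ : Measure ℝ) [IsProbabilityMeasure Q₀] : Kernel ℝ ℝ where
  toFun lam := Q₀.tilted (fun y => lam * y)
  measurable' := by
    refine Measure.measurable_of_measurable_coe _ fun s hs => ?_
    simp_rw [tilted_apply' _ _ hs]
    have h1 : Measurable fun p : ℝ × ℝ => Real.exp (p.1 * p.2) := by fun_prop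
    have h2 : Measurable fun l : ℝ => ∫ y, Real.exp (l * y) ∂Q₀ :=
      (h1.stronglyMeasurable.integral_prod_right').measurable
    have h3 : Measurable fun p : ℝ × ℝ =>
        ENNReal.ofReal (Real.exp (p.1 * p.2) / ∫ y, Real.exp (p.1 * y) ∂Q₀) :=
      (h1.div (h2.comp measurable_fst)).ennreal_ofReal
    exact h3.lintegral_prod_right'

/-- A parameter `f` of the functional generalized linear model: the intercept `a`, the law of the
covariate `X` (for a Gaussian covariate this is the same as its mean and its covariance kernel),
and the slope `B`. -/
structure Param where
  /-- the intercept `a` -/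
  intercept : ℝ
  /-- the law of the covariate `X` in `L²[0,1]` -/
  covLaw : Measure L2I
  /-- the slope function `B` -/
  slope : L2I

/-- The conditional law `Q_lam` of the response given the covariate `x`, where
`lam = a + ∫ B(t) x(t) dt`. -/
noncomputable def responseKernel (Q₀ : Measure ℝ) [IsProbabilityMeasure Q₀] (f : Param) :
    Kernel L2I ℝ :=
  (expFamily Q₀).comap (fun x => f.intercept + ⟪f.slope, x⟫_ℝ) (by fun_prop)

/-- The law `P_{n,f}` of `n` independent observations `(X_i, y_i)`. -/
noncomputable def obsLaw (Q₀ : Measure ℝ) [IsProbabilityMeasure Q₀] (n : ℕ) (f : Param) :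
    Measure (Fin n → L2I × ℝ) :=
  Measure.pi fun _ => f.covLaw ⊗ₘ responseKernel Q₀ f

/-- The risk `P_{n,f} ‖B - B̂‖²` of an estimator `B̂`, with values in `[0, ∞]`. -/
noncomputable def risk (Q₀ : Measure ℝ) [IsProbabilityMeasure Q₀] (n : ℕ) (f : Param)
    (Bhat : (Fin n → L2I × ℝ) → L2I) : ℝ≥0∞ :=
  ∫⁻ d, ‖f.slope - Bhat d‖ₑ ^ 2 ∂(obsLaw Q₀ n f)

/-- `ν` is the law of a centred Gaussian random element `X` of `L²[0,1]` with covariance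
kernel `K`, that is, `Cov(⟪u, X⟫, ⟪v, X⟫) = ∫∫ K(s,t) u(s) v(t) dt ds` for all `u`, `v`. -/
structure IsCentredGaussianLaw (ν : Measure L2I) (K : ℝ → ℝ → ℝ) : Prop where
  isGaussian : IsGaussian ν
  mean_eq_zero : ∫ x, x ∂ν = 0
  covariance_eq : ∀ u v : L2I, cov[fun x => ⟪u, x⟫_ℝ, fun x => ⟪v, x⟫_ℝ; ν] =
    ∫ s in Icc (0 : ℝ) 1, ∫ t in Icc (0 : ℝ) 1, K s t * u s * v t

/-- The square-integrable kernel `K` on `[0,1]²` has the spectral decomposition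
`K = ∑ⱼ θⱼ φⱼ ⊗ φⱼ` with orthonormal eigenfunctions `φⱼ`
(the index `j : ℕ` stands for the `(j+1)`-st eigenvalue and eigenfunction). -/
structure HasSpectralDecomposition (K : ℝ → ℝ → ℝ) (θ : ℕ → ℝ) (φ : ℕ → L2I) : Prop where
  memLp : MemLp (fun p : ℝ × ℝ => K p.1 p.2) 2
    ((volume.restrict (Icc (0 : ℝ) 1)).prod (volume.restrict (Icc (0 : ℝ) 1)))
  orthonormal : Orthonormal ℝ φ
  hasSum : ∀ u v : L2I, HasSum (fun j => θ j * ⟪φ j, u⟫_ℝ * ⟪φ j, v⟫_ℝ)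
    (∫ s in Icc (0 : ℝ) 1, ∫ t in Icc (0 : ℝ) 1, K s t * u s * v t)

/-- The slopes `B = ∑_{j ≥ 1} bⱼ φⱼ` with `|bⱼ| ≤ R j^{-β}`, numbered from `j = 0` in the code. -/
def slopeClass (φ : ℕ → L2I) (R β : ℝ) : Set L2I :=
  {B | ∃ b : ℕ → ℝ, (∀ j, |b j| ≤ R * ((j : ℝ) + 1) ^ (-β)) ∧ HasSum (fun j => b j • φ j) B}

/-- The sub-problem with `a = 0` and a fixed covariate law: only the slope varies. -/
def subProblem (ν : Measure L2I) (φ : ℕ → L2I) (R β : ℝ) : Set Param :=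
  {f | f.intercept = 0 ∧ f.covLaw = ν ∧ f.slope ∈ slopeClass φ R β}

/-- The rate `ρ_n = n^{(1-2β)/(α+2β)}`. -/
noncomputable def rate (α β : ℝ) (n : ℕ) : ℝ := (n : ℝ) ^ ((1 - 2 * β) / (α + 2 * β))

/-- If every exponential moment of `Q₀` is finite, each `Q_lam` is a probability measure. -/
lemma isMarkovKernel_expFamily (Q₀ : Measure ℝ) [IsProbabilityMeasure Q₀]
    (hQ : ∀ lam : ℝ, Integrable (fun y => Real.exp (lam * y)) Q₀) :
    IsMarkovKernel (expFamily Q₀) :=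
  ⟨fun lam => isProbabilityMeasure_tilted (hQ lam)⟩

/-- The law of the observations is then a probability measure. -/
lemma isProbabilityMeasure_obsLaw (Q₀ : Measure ℝ) [IsProbabilityMeasure Q₀]
    (hQ : ∀ lam : ℝ, Integrable (fun y => Real.exp (lam * y)) Q₀) (n : ℕ) (f : Param)
    (hf : IsProbabilityMeasure f.covLaw) : IsProbabilityMeasure (obsLaw Q₀ n f) := by
  have := isMarkovKernel_expFamily Q₀ hQ
  unfold obsLaw responseKernel
  infer_instance

end FunctionalGLM

/-!
The lower bound is proved with Assouad's method on a cube of slopes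
`B_T = ∑ j ∈ T, e • φ j`, where `T` ranges over the subsets of the block `[J, 2 * J)`, `J` is of
the order of `n ^ (1 / (α + 2 * β))` and `e` is a small multiple of `J ^ (-β)`
(`eventually_exists_cube`).

Bessel's inequality bounds the risk below by the sum of the risks in the `J` coordinates. For each
coordinate, two vertices of the cube that differ only there have coordinate risks adding up to at
least a multiple of `e ^ 2`, unless the two laws of the `n` observations can be told apart. So some
vertex has risk at least a multiple of `J * e ^ 2`, which is of the order of
`J ^ (1 - 2 * β)`, the asserted rate (`exists_card_mul_le_two_mul_risk`).

That neighbouring vertices `u`, `v` are indistinguishable is measured by the Hellinger affinity,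
which is multiplicative over the observations. In an exponential family with cumulant generating
function `ψ` the affinity of one observation is
`𝔼 exp (ψ ((a + b) / 2) - (ψ a + ψ b) / 2)` with `a = ⟪u, X⟫` and `b = ⟪v, X⟫`
(`lintegral_sqrtDensity_mul`). Since `ψ''` may be unbounded, the Jensen gap is bounded by a multiple
of `(a - b) ^ 2` only where `|a| ≤ 1` and `|b| ≤ 1` (`exists_one_le_affinity_add`). The second
moment of `a - b` is `θ j * e ^ 2`, at most a small multiple of `1 / n`. The variances of `a` and
`b` are at most of the order of `1 / J`, so by Gaussianity the exceptional event has probability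
exponentially small in `J`, far below `1 / n`. The affinity of `n` observations is therefore at
least `1 / 2` (`half_le_affinity_pow`).
-/

namespace FunctionalGLM

/-! ### Testing between two densities -/

/-- Le Cam's inequality between the Hellinger affinity and the testing affinity, for the densities
`f ^ 2` and `g ^ 2`: apply Cauchy–Schwarz to `f * g = min f g * max f g`. -/
lemma sq_lintegral_mul_le_two_mul_lintegral_min {α : Type*} [MeasurableSpace α] {μ : Measure α}
    {f g : α → ℝ≥0∞} (hf : Measurable f) (hg : Measurable g)
    (hf1 : ∫⁻ x, f x ^ 2 ∂μ ≤ 1) (hg1 : ∫⁻ x, g x ^ 2 ∂μ ≤ 1) :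
    (∫⁻ x, f x * g x ∂μ) ^ 2 ≤ 2 * ∫⁻ x, min (f x ^ 2) (g x ^ 2) ∂μ := by
  have hcs := ENNReal.lintegral_mul_le_Lp_mul_Lq μ Real.HolderConjugate.two_two
    (hf.min hg).aemeasurable (hf.max hg).aemeasurable
  have hmul : ∀ x, ((fun x => min (f x) (g x)) * fun x => max (f x) (g x)) x = f x * g x :=
    fun x => by simp [min_mul_max]
  simp_rw [hmul, ENNReal.rpow_two] at hcs
  have hmin : ∀ x, (min (f x) (g x)) ^ 2 = min (f x ^ 2) (g x ^ 2) := fun x =>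
    (pow_left_mono 2 : Monotone fun a : ℝ≥0∞ => a ^ 2).map_min
  have hmax : ∫⁻ x, (max (f x) (g x)) ^ 2 ∂μ ≤ 2 := by
    calc ∫⁻ x, (max (f x) (g x)) ^ 2 ∂μ ≤ ∫⁻ x, (f x ^ 2 + g x ^ 2) ∂μ := by
          refine lintegral_mono fun x => ?_
          rcases le_total (f x) (g x) with h | h <;> simp [h]
      _ = ∫⁻ x, f x ^ 2 ∂μ + ∫⁻ x, g x ^ 2 ∂μ := lintegral_add_left (hf.pow_const 2) _
      _ ≤ 1 + 1 := add_le_add hf1 hg1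
      _ = 2 := one_add_one_eq_two
  have hsq : ∀ a : ℝ≥0∞, (a ^ (1 / (2 : ℝ))) ^ 2 = a := fun a => by
    rw [← ENNReal.rpow_two, ← ENNReal.rpow_mul]; simp
  calc (∫⁻ x, f x * g x ∂μ) ^ 2
      ≤ ((∫⁻ x, (min (f x) (g x)) ^ 2 ∂μ) ^ (1 / (2 : ℝ)) *
          (∫⁻ x, (max (f x) (g x)) ^ 2 ∂μ) ^ (1 / (2 : ℝ))) ^ 2 := by gcongr
    _ = (∫⁻ x, (max (f x) (g x)) ^ 2 ∂μ) * ∫⁻ x, min (f x ^ 2) (g x ^ 2) ∂μ := by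
        rw [mul_pow, hsq, hsq, mul_comm]; simp_rw [hmin]
    _ ≤ _ := by gcongr

/-- Estimating a real parameter that takes the value `a` under the density `p` and `b` under the
density `q`: the sum of the two quadratic risks is at least `(a - b) ^ 2 / 2` times the testing
affinity. -/
lemma half_sq_mul_lintegral_min_le {α : Type*} [MeasurableSpace α] {μ : Measure α}
    {p q : α → ℝ≥0∞} (hp : Measurable p) (hq : Measurable q) {h : α → ℝ} (hh : Measurable h)
    (a b : ℝ) :
    ENNReal.ofReal ((a - b) ^ 2 / 2) * ∫⁻ x, min (p x) (q x) ∂μ ≤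
      ∫⁻ x, ENNReal.ofReal ((a - h x) ^ 2) ∂(μ.withDensity p) +
        ∫⁻ x, ENNReal.ofReal ((b - h x) ^ 2) ∂(μ.withDensity q) := by
  have ha : Measurable fun x => ENNReal.ofReal ((a - h x) ^ 2) := by fun_prop
  have hb : Measurable fun x => ENNReal.ofReal ((b - h x) ^ 2) := by fun_prop
  rw [lintegral_withDensity_eq_lintegral_mul _ hp ha, lintegral_withDensity_eq_lintegral_mul _ hq hb,
    ← lintegral_add_left (hp.mul ha), ← lintegral_const_mul _ (hp.min hq)]
  refine lintegral_mono fun x => ?_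
  simp only [Pi.mul_apply]
  calc ENNReal.ofReal ((a - b) ^ 2 / 2) * min (p x) (q x)
      ≤ ENNReal.ofReal ((a - h x) ^ 2 + (b - h x) ^ 2) * min (p x) (q x) := by
        gcongr
        -- the parallelogram identity for `a - h x` and `b - h x`
        nlinarith [sq_nonneg ((a - h x) + (b - h x))]
    _ = min (p x) (q x) * ENNReal.ofReal ((a - h x) ^ 2) +
          min (p x) (q x) * ENNReal.ofReal ((b - h x) ^ 2) := by
        rw [ENNReal.ofReal_add (sq_nonneg _) (sq_nonneg _)]; ring
    _ ≤ _ := by gcongr <;> simp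

/-! ### Densities on finite products -/

lemma lintegral_pi_prod {α : Type*} [MeasurableSpace α] (μ : Measure α) [IsProbabilityMeasure μ]
    {n : ℕ} {f : Fin n → α → ℝ≥0∞} (hf : ∀ i, Measurable (f i)) :
    ∫⁻ x : Fin n → α, ∏ i, f i (x i) ∂(Measure.pi fun _ => μ) = ∏ i, ∫⁻ x, f i x ∂μ := by
  have hind : iIndepFun (fun i (x : Fin n → α) => f i (x i)) (Measure.pi fun _ => μ) :=
    iIndepFun_pi (X := f) fun i => (hf i).aemeasurable
  rw [lintegral_prod_eq_prod_lintegral_of_indepFun Finset.univ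
    (fun i (x : Fin n → α) => f i (x i)) hind fun i => (hf i).comp (measurable_pi_apply i)]
  refine Finset.prod_congr rfl fun i _ => ?_
  exact (measurePreserving_eval (fun _ : Fin n => μ) i).lintegral_comp (hf i)

lemma pi_withDensity_eq {α : Type*} [MeasurableSpace α] (μ : Measure α) [IsProbabilityMeasure μ]
    {p : α → ℝ≥0∞} (hp : Measurable p) [SigmaFinite (μ.withDensity p)] (n : ℕ) :
    Measure.pi (fun _ : Fin n => μ.withDensity p) =
      (Measure.pi fun _ : Fin n => μ).withDensity fun x => ∏ i, p (x i) := by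
  refine Measure.pi_eq fun s hs => ?_
  rw [withDensity_apply _ (MeasurableSet.univ_pi hs),
    ← lintegral_indicator (MeasurableSet.univ_pi hs)]
  have hind : ∀ x : Fin n → α, (univ.pi s).indicator (fun x => ∏ i, p (x i)) x =
      ∏ i, (s i).indicator p (x i) := fun x => by
    by_cases hx : x ∈ univ.pi s
    · rw [indicator_of_mem hx]
      exact Finset.prod_congr rfl fun i _ => (indicator_of_mem (hx i (mem_univ i)) _).symm
    · rw [indicator_of_notMem hx]
      obtain ⟨i, hi⟩ : ∃ i, x i ∉ s i := by simpa [mem_univ_pi] using hx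
      exact (Finset.prod_eq_zero (Finset.mem_univ i) (indicator_of_notMem hi _)).symm
  simp_rw [hind]
  rw [lintegral_pi_prod μ fun i => hp.indicator (hs i)]
  refine Finset.prod_congr rfl fun i _ => ?_
  rw [lintegral_indicator (hs i), withDensity_apply _ (hs i)]

/-! ### Averaging over the hypercube -/

/-- Assouad's lemma in combinatorial form. The subsets `S` of `ι` are the vertices of the cube, and
`r S i` is the risk in the `i`-th coordinate. If the two endpoints of every edge in direction `i`
have coordinate risks adding up to at least `d`, then some vertex has total risk at least
`card ι * d / 2`. -/
lemma exists_card_mul_le_two_mul_sum {ι : Type*} [Fintype ι] [DecidableEq ι]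
    (r : Finset ι → ι → ℝ≥0∞) (d : ℝ≥0∞) (h : ∀ S i, d ≤ r S i + r (symmDiff {i} S) i) :
    ∃ S, Fintype.card ι * d ≤ 2 * ∑ i, r S i := by
  suffices hsum : ∑ _S : Finset ι, Fintype.card ι * d ≤ ∑ S : Finset ι, 2 * ∑ i, r S i by
    obtain ⟨S, -, hS⟩ := ENNReal.exists_le_of_sum_le Finset.univ_nonempty hsum
    exact ⟨S, hS⟩
  calc ∑ _S : Finset ι, Fintype.card ι * d = ∑ _i : ι, ∑ _S : Finset ι, d := by
        simp only [Finset.sum_const, Finset.card_univ, nsmul_eq_mul]; ring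
    _ ≤ ∑ i : ι, ∑ S : Finset ι, (r S i + r (symmDiff {i} S) i) := by
        gcongr with i _ S _; exact h S i
    _ = ∑ i : ι, ∑ S : Finset ι, 2 * r S i := by
        refine Finset.sum_congr rfl fun i _ => ?_
        have hflip : ∑ S : Finset ι, r (symmDiff {i} S) i = ∑ S, r S i :=
          Equiv.sum_comp (symmDiff_right_involutive ({i} : Finset ι)).toPerm fun S => r S i
        rw [Finset.sum_add_distrib, hflip, ← Finset.mul_sum, two_mul]
    _ = ∑ S : Finset ι, 2 * ∑ i, r S i := by
        rw [Finset.sum_comm]; simp_rw [Finset.mul_sum]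

/-! ### The Hellinger affinity of two slopes -/

/-- The square root of the density of one observation `(x, y)`, for intercept `0`, slope `B` and
covariate law `ν`, with respect to the product of `ν` and `Q₀`. The root is the basic object
because the affinity of two laws is the integral of the product of their roots. -/
noncomputable def sqrtDensity (Q₀ : Measure ℝ) (B : L2I) (p : L2I × ℝ) : ℝ≥0∞ :=
  ENNReal.ofReal (Real.exp ((⟪B, p.1⟫_ℝ * p.2 - cgf id Q₀ ⟪B, p.1⟫_ℝ) / 2))

lemma analyticOnNhd_cgf_id {Q₀ : Measure ℝ}
    (hQ : ∀ lam : ℝ, Integrable (fun y => Real.exp (lam * y)) Q₀) :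
    AnalyticOnNhd ℝ (cgf id Q₀) univ := by
  have huniv : integrableExpSet id Q₀ = univ := eq_univ_of_forall hQ
  simpa [huniv] using analyticOnNhd_cgf (X := id) (μ := Q₀)

lemma continuous_cgf_id {Q₀ : Measure ℝ}
    (hQ : ∀ lam : ℝ, Integrable (fun y => Real.exp (lam * y)) Q₀) : Continuous (cgf id Q₀) :=
  continuousOn_univ.1 (analyticOnNhd_cgf_id hQ).continuousOn

lemma measurable_sqrtDensity {Q₀ : Measure ℝ}
    (hQ : ∀ lam : ℝ, Integrable (fun y => Real.exp (lam * y)) Q₀) (B : L2I) :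
    Measurable (sqrtDensity Q₀ B) := by
  have hψ := (continuous_cgf_id hQ).measurable
  have hB : Measurable fun p : L2I × ℝ => ⟪B, p.1⟫_ℝ := by fun_prop
  exact (Real.measurable_exp.comp
    (((hB.mul measurable_snd).sub (hψ.comp hB)).div_const 2)).ennreal_ofReal

lemma sqrtDensity_sq (Q₀ : Measure ℝ) (B : L2I) (p : L2I × ℝ) :
    sqrtDensity Q₀ B p ^ 2 =
      ENNReal.ofReal (Real.exp (⟪B, p.1⟫_ℝ * p.2 - cgf id Q₀ ⟪B, p.1⟫_ℝ)) := by
  rw [sqrtDensity, ← ENNReal.ofReal_pow (Real.exp_pos _).le, ← Real.exp_nat_mul]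
  congr 2; push_cast; ring

lemma compProd_responseKernel_eq_withDensity (Q₀ : Measure ℝ) [IsProbabilityMeasure Q₀]
    (hQ : ∀ lam : ℝ, Integrable (fun y => Real.exp (lam * y)) Q₀) (ν : Measure L2I) [SFinite ν]
    (f : Param) (hf : f.intercept = 0) :
    ν ⊗ₘ responseKernel Q₀ f =
      (ν.prod Q₀).withDensity fun p => sqrtDensity Q₀ f.slope p ^ 2 := by
  have := isMarkovKernel_expFamily Q₀ hQ
  have : IsMarkovKernel (responseKernel Q₀ f) := by unfold responseKernel; infer_instance
  have hm : Measurable fun p => sqrtDensity Q₀ f.slope p ^ 2 :=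
    (measurable_sqrtDensity hQ f.slope).pow_const 2
  ext s hs
  rw [Measure.compProd_apply hs, withDensity_apply _ hs, ← lintegral_indicator hs,
    lintegral_prod _ (hm.indicator hs).aemeasurable]
  refine lintegral_congr fun x => ?_
  have hk : responseKernel Q₀ f x = Q₀.tilted (fun y => ⟪f.slope, x⟫_ℝ * id y) := by
    simp [responseKernel, hf, Kernel.comap_apply, expFamily]
  rw [hk, tilted_mul_apply_cgf (X := id) _ (hQ _), ← lintegral_indicator (measurable_prodMk_left hs)]
  refine lintegral_congr fun y => ?_
  by_cases hy : (x, y) ∈ s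
  · rw [indicator_of_mem hy, indicator_of_mem (show y ∈ Prod.mk x ⁻¹' s from hy), sqrtDensity_sq]
    rfl
  · rw [indicator_of_notMem hy, indicator_of_notMem (show y ∉ Prod.mk x ⁻¹' s from hy)]

lemma obsLaw_eq_withDensity (Q₀ : Measure ℝ) [IsProbabilityMeasure Q₀]
    (hQ : ∀ lam : ℝ, Integrable (fun y => Real.exp (lam * y)) Q₀) (n : ℕ) (ν : Measure L2I)
    [IsProbabilityMeasure ν] (B : L2I) :
    obsLaw Q₀ n ⟨0, ν, B⟩ = (Measure.pi fun _ : Fin n => ν.prod Q₀).withDensity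
      fun d => (∏ i, sqrtDensity Q₀ B (d i)) ^ 2 := by
  have := isMarkovKernel_expFamily Q₀ hQ
  have hone := compProd_responseKernel_eq_withDensity Q₀ hQ ν ⟨0, ν, B⟩ rfl
  have : IsProbabilityMeasure (ν ⊗ₘ responseKernel Q₀ ⟨0, ν, B⟩) := by
    unfold responseKernel; infer_instance
  rw [hone] at this
  simp_rw [obsLaw, hone, ← Finset.prod_pow]
  exact pi_withDensity_eq (ν.prod Q₀) ((measurable_sqrtDensity hQ B).pow_const 2) n

/-- The affinity of two members of an exponential family is the exponential of minus the Jensen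
gap of the cumulant generating function; the covariate is then averaged out. -/
lemma lintegral_sqrtDensity_mul (Q₀ : Measure ℝ) [IsProbabilityMeasure Q₀]
    (hQ : ∀ lam : ℝ, Integrable (fun y => Real.exp (lam * y)) Q₀) (ν : Measure L2I) [SFinite ν]
    (u v : L2I) :
    ∫⁻ p, sqrtDensity Q₀ u p * sqrtDensity Q₀ v p ∂(ν.prod Q₀) =
      ∫⁻ x, ENNReal.ofReal (Real.exp (cgf id Q₀ ((⟪u, x⟫_ℝ + ⟪v, x⟫_ℝ) / 2) -
        (cgf id Q₀ ⟪u, x⟫_ℝ + cgf id Q₀ ⟪v, x⟫_ℝ) / 2)) ∂ν := by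
  have hm : Measurable fun p => sqrtDensity Q₀ u p * sqrtDensity Q₀ v p :=
    (measurable_sqrtDensity hQ u).mul (measurable_sqrtDensity hQ v)
  rw [lintegral_prod _ hm.aemeasurable]
  refine lintegral_congr fun x => ?_
  set a := ⟪u, x⟫_ℝ with ha
  set b := ⟪v, x⟫_ℝ with hb
  have hint : ∀ y : ℝ, sqrtDensity Q₀ u (x, y) * sqrtDensity Q₀ v (x, y) =
      ENNReal.ofReal (Real.exp (-((cgf id Q₀ a + cgf id Q₀ b) / 2))) *
        ENNReal.ofReal (Real.exp ((a + b) / 2 * y)) := fun y => by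
    simp only [sqrtDensity, ← ha, ← hb]
    rw [← ENNReal.ofReal_mul (Real.exp_pos _).le, ← ENNReal.ofReal_mul (Real.exp_pos _).le,
      ← Real.exp_add, ← Real.exp_add]
    congr 2; ring
  simp_rw [hint]
  rw [lintegral_const_mul _ (by fun_prop),
    ← ofReal_integral_eq_lintegral_ofReal (hQ _) (ae_of_all _ fun y => (Real.exp_pos _).le),
    ← ENNReal.ofReal_mul (Real.exp_pos _).le, sub_eq_neg_add, Real.exp_add,
    exp_cgf (X := id) (hQ _)]
  rfl

lemma lintegral_sqrtDensity_sq (Q₀ : Measure ℝ) [IsProbabilityMeasure Q₀]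
    (hQ : ∀ lam : ℝ, Integrable (fun y => Real.exp (lam * y)) Q₀) (ν : Measure L2I)
    [IsProbabilityMeasure ν] (u : L2I) : ∫⁻ p, sqrtDensity Q₀ u p ^ 2 ∂(ν.prod Q₀) = 1 := by
  simp_rw [sq]
  rw [lintegral_sqrtDensity_mul Q₀ hQ]
  simp

/-- On `[-1, 1]` the Jensen gap of the cumulant generating function `ψ` is quadratically small,
because `ψ t - C * t ^ 2 / 2` is concave there as soon as `C` bounds `ψ''`. -/
lemma exists_cgf_jensen_gap_le {Q₀ : Measure ℝ}
    (hQ : ∀ lam : ℝ, Integrable (fun y => Real.exp (lam * y)) Q₀) :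
    ∃ C : ℝ, 0 ≤ C ∧ ∀ a ∈ Icc (-1 : ℝ) 1, ∀ b ∈ Icc (-1 : ℝ) 1,
      (cgf id Q₀ a + cgf id Q₀ b) / 2 - cgf id Q₀ ((a + b) / 2) ≤ C * (a - b) ^ 2 := by
  set ψ := cgf id Q₀ with hψ
  have han := analyticOnNhd_cgf_id hQ
  have hd : Differentiable ℝ ψ := fun x => (han x (mem_univ x)).differentiableAt
  have hd1 : Differentiable ℝ (deriv ψ) := fun x => (han.deriv x (mem_univ x)).differentiableAt
  have hc : Continuous (deriv (deriv ψ)) := continuousOn_univ.1 han.deriv.deriv.continuousOn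
  obtain ⟨C, hC⟩ := (isCompact_Icc (a := (-1 : ℝ)) (b := 1)).exists_bound_of_continuousOn
    hc.continuousOn
  have hC0 : 0 ≤ C := (norm_nonneg _).trans (hC 0 (by simp))
  have hder : deriv (fun t => ψ t - C * t ^ 2 / 2) = fun t => deriv ψ t - C * t := by
    ext t
    have h := ((hd t).hasDerivAt).sub (((hasDerivAt_pow 2 t).const_mul C).div_const 2)
    refine h.deriv.trans ?_
    push_cast; ring
  have hder2 : ∀ t, deriv (fun t => deriv ψ t - C * t) t = deriv (deriv ψ) t - C := fun t => by
    have h := ((hd1 t).hasDerivAt).sub ((hasDerivAt_id t).const_mul C)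
    refine h.deriv.trans ?_
    ring
  have hconc : ConcaveOn ℝ (Icc (-1 : ℝ) 1) fun t => ψ t - C * t ^ 2 / 2 := by
    refine concaveOn_of_deriv2_nonpos' (convex_Icc _ _)
      (hd.sub (by fun_prop)).differentiableOn ?_ fun t ht => ?_
    · rw [hder]; exact (hd1.sub (by fun_prop)).differentiableOn
    · simp only [Function.iterate_succ, Function.iterate_zero, Function.comp_apply, id, hder, hder2]
      linarith [(Real.norm_eq_abs _ ▸ le_abs_self _).trans (hC t ht)]
  refine ⟨C / 8, by positivity, fun a ha b hb => ?_⟩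
  have h := hconc.2 ha hb (by norm_num : (0 : ℝ) ≤ 1 / 2) (by norm_num : (0 : ℝ) ≤ 1 / 2)
    (by norm_num)
  simp only [smul_eq_mul] at h
  rw [show 1 / 2 * a + 1 / 2 * b = (a + b) / 2 by ring] at h
  nlinarith

/-- The affinity of two slopes is close to one: where both linear predictors are at most one in
absolute value the Jensen gap is quadratic, and elsewhere the affinity is bounded below by zero. -/
lemma exists_one_le_affinity_add (Q₀ : Measure ℝ) [IsProbabilityMeasure Q₀]
    (hQ : ∀ lam : ℝ, Integrable (fun y => Real.exp (lam * y)) Q₀) (ν : Measure L2I)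
    [IsGaussian ν] :
    ∃ C : ℝ, 0 ≤ C ∧ ∀ u v : L2I,
      1 ≤ ∫⁻ p, sqrtDensity Q₀ u p * sqrtDensity Q₀ v p ∂(ν.prod Q₀) +
        (ν {x | 1 < |⟪u, x⟫_ℝ|} + (ν {x | 1 < |⟪v, x⟫_ℝ|} +
          ENNReal.ofReal (C * ∫ x, ⟪u - v, x⟫_ℝ ^ 2 ∂ν))) := by
  obtain ⟨C, hC0, hC⟩ := exists_cgf_jensen_gap_le hQ
  refine ⟨C, hC0, fun u v => ?_⟩
  have hsetm : ∀ w : L2I, MeasurableSet {x : L2I | 1 < |⟪w, x⟫_ℝ|} := fun w =>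
    measurableSet_lt measurable_const (by fun_prop)
  have hψ := (continuous_cgf_id hQ).measurable
  have hexp : Measurable fun x : L2I => ENNReal.ofReal (Real.exp
      (cgf id Q₀ ((⟪u, x⟫_ℝ + ⟪v, x⟫_ℝ) / 2) -
        (cgf id Q₀ ⟪u, x⟫_ℝ + cgf id Q₀ ⟪v, x⟫_ℝ) / 2)) := by fun_prop
  have hint : Integrable (fun x => C * ⟪u - v, x⟫_ℝ ^ 2) ν :=
    ((IsGaussian.memLp_dual ν (innerSL ℝ (u - v)) 2 (by simp)).integrable_sq).const_mul C
  have hind : ∀ w : L2I, ν {x | 1 < |⟪w, x⟫_ℝ|} =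
      ∫⁻ x, {x : L2I | 1 < |⟪w, x⟫_ℝ|}.indicator 1 x ∂ν := fun w => by
    rw [lintegral_indicator_one (hsetm w)]
  rw [lintegral_sqrtDensity_mul Q₀ hQ, ← integral_const_mul,
    ofReal_integral_eq_lintegral_ofReal hint (ae_of_all _ fun x => by positivity), hind u, hind v,
    ← lintegral_add_left (measurable_one.indicator (hsetm v)),
    ← lintegral_add_left (measurable_one.indicator (hsetm u)), ← lintegral_add_left hexp]
  calc (1 : ℝ≥0∞) = ∫⁻ _, 1 ∂ν := by simp
    _ ≤ _ := lintegral_mono fun x => ?_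
  by_cases hu : 1 < |⟪u, x⟫_ℝ|
  · rw [indicator_of_mem (show x ∈ {x : L2I | 1 < |⟪u, x⟫_ℝ|} from hu)]
    exact le_add_left (le_add_right le_rfl)
  by_cases hv : 1 < |⟪v, x⟫_ℝ|
  · rw [indicator_of_mem (show x ∈ {x : L2I | 1 < |⟪v, x⟫_ℝ|} from hv)]
    exact le_add_left (le_add_left (le_add_right le_rfl))
  have hgap := hC _ (abs_le.1 (not_lt.1 hu)) _ (abs_le.1 (not_lt.1 hv))
  rw [← inner_sub_left] at hgap
  refine le_trans ?_ (add_le_add_right (le_add_left le_add_self) _)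
  rw [← ENNReal.ofReal_add (Real.exp_pos _).le (by positivity), ← ENNReal.ofReal_one]
  refine ENNReal.ofReal_le_ofReal ?_
  linarith [Real.add_one_le_exp (cgf id Q₀ ((⟪u, x⟫_ℝ + ⟪v, x⟫_ℝ) / 2) -
        (cgf id Q₀ ⟪u, x⟫_ℝ + cgf id Q₀ ⟪v, x⟫_ℝ) / 2)]

/-! ### The Gaussian linear predictor -/

namespace IsCentredGaussianLaw

variable {ν : Measure L2I} {K : ℝ → ℝ → ℝ}

lemma integral_inner_eq_zero (hν : IsCentredGaussianLaw ν K) (u : L2I) :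
    ∫ x, ⟪u, x⟫_ℝ ∂ν = 0 := by
  have := hν.isGaussian
  rw [integral_inner (f := fun x => x) IsGaussian.integrable_id, hν.mean_eq_zero, inner_zero_right]

lemma variance_inner (hν : IsCentredGaussianLaw ν K) (u : L2I) :
    Var[fun x => ⟪u, x⟫_ℝ; ν] = ∫ x, ⟪u, x⟫_ℝ ^ 2 ∂ν :=
  variance_of_integral_eq_zero (by fun_prop) (hν.integral_inner_eq_zero u)

/-- The second moment of `⟪u, X⟫` when `u` has only finitely many nonzero coefficients along the
eigenfunctions. -/
lemma integral_inner_sq_eq_sum (hν : IsCentredGaussianLaw ν K) {θ : ℕ → ℝ} {φ : ℕ → L2I}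
    (hK : HasSpectralDecomposition K θ φ) (u : L2I) (T : Finset ℕ)
    (hT : ∀ j ∉ T, ⟪φ j, u⟫_ℝ = 0) :
    ∫ x, ⟪u, x⟫_ℝ ^ 2 ∂ν = ∑ j ∈ T, θ j * ⟪φ j, u⟫_ℝ ^ 2 := by
  have hcov := hν.covariance_eq u u
  rw [covariance_self (by fun_prop), hν.variance_inner] at hcov
  rw [hcov, (hK.hasSum u u).unique (hasSum_sum_of_ne_finset_zero fun j hj => by simp [hT j hj])]
  exact Finset.sum_congr rfl fun j _ => by ring

lemma measure_one_lt_abs_inner_le (hν : IsCentredGaussianLaw ν K) (u : L2I) {s : ℝ} (hs : 0 < s)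
    (hu : ∫ x, ⟪u, x⟫_ℝ ^ 2 ∂ν ≤ s) :
    ν {x | 1 < |⟪u, x⟫_ℝ|} ≤ ENNReal.ofReal (2 * Real.exp (-1 / (2 * s))) := by
  have := hν.isGaussian
  have hsub : ∀ w : L2I, ∫ x, ⟪w, x⟫_ℝ ^ 2 ∂ν ≤ s →
      HasSubgaussianMGF (fun x => ⟪w, x⟫_ℝ) s.toNNReal ν := fun w hw => by
    have hmap : ν.map (fun x => ⟪w, x⟫_ℝ) =
        gaussianReal 0 (∫ x, ⟪w, x⟫_ℝ ^ 2 ∂ν).toNNReal := by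
      have h := IsGaussian.map_eq_gaussianReal (μ := ν) (innerSL ℝ w)
      have h0 : ν[innerSL ℝ w] = 0 := hν.integral_inner_eq_zero w
      have h1 : Var[innerSL ℝ w; ν] = ∫ x, ⟪w, x⟫_ℝ ^ 2 ∂ν := hν.variance_inner w
      rw [h0, h1] at h
      exact h
    refine ⟨fun t => ?_, fun t => ?_⟩
    · have hi := integrable_exp_mul_gaussianReal (μ := 0)
        (v := (∫ x, ⟪w, x⟫_ℝ ^ 2 ∂ν).toNNReal) t
      rw [← hmap] at hi
      exact hi.comp_measurable (by fun_prop)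
    · rw [mgf_gaussianReal hmap, zero_mul, zero_add]
      gcongr
  -- The two tails are the upper tails of `u` and of `-u`.
  have hneg : ∫ x, ⟪-u, x⟫_ℝ ^ 2 ∂ν ≤ s := by simpa using hu
  have hcoe : (s.toNNReal : ℝ) = s := Real.coe_toNNReal s hs.le
  have h1 := (hsub u hu).measure_ge_le zero_le_one
  have h2 := (hsub (-u) hneg).measure_ge_le zero_le_one
  rw [hcoe, one_pow] at h1 h2
  have hle : ν.real {x | 1 < |⟪u, x⟫_ℝ|} ≤ 2 * Real.exp (-1 / (2 * s)) := by
    calc ν.real {x | 1 < |⟪u, x⟫_ℝ|}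
        ≤ ν.real ({x | 1 ≤ ⟪u, x⟫_ℝ} ∪ {x | 1 ≤ ⟪-u, x⟫_ℝ}) := by
          refine measureReal_mono fun x hx => ?_
          rcases lt_abs.1 (show 1 < |⟪u, x⟫_ℝ| from hx) with h | h
          · exact Or.inl h.le
          · exact Or.inr (by simpa using h.le)
      _ ≤ _ := (measureReal_union_le _ _).trans (by linarith)
  rw [← ofReal_measureReal]
  exact ENNReal.ofReal_le_ofReal hle

end IsCentredGaussianLaw

/-! ### The hypercube of slopes -/

/-- The slope with coefficient `e` along `φ j` for `j ∈ T`, and `0` along the other `φ j`. -/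
noncomputable def cubeSlope (φ : ℕ → L2I) (e : ℝ) (T : Finset ℕ) : L2I := ∑ j ∈ T, e • φ j

lemma inner_cubeSlope {φ : ℕ → L2I} (hφ : Orthonormal ℝ φ) (e : ℝ) (T : Finset ℕ) (k : ℕ) :
    ⟪φ k, cubeSlope φ e T⟫_ℝ = if k ∈ T then e else 0 := by
  simp [cubeSlope, inner_sum, inner_smul_right, orthonormal_iff_ite.1 hφ]

lemma cubeSlope_mem_slopeClass (φ : ℕ → L2I) {R β e : ℝ} (hR : 0 ≤ R) (he : 0 ≤ e)
    (T : Finset ℕ) (h : ∀ j ∈ T, e ≤ R * ((j : ℝ) + 1) ^ (-β)) :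
    cubeSlope φ e T ∈ slopeClass φ R β := by
  refine ⟨fun j => if j ∈ T then e else 0, fun j => ?_, ?_⟩
  · by_cases hj : j ∈ T
    · simpa [hj, abs_of_nonneg he] using h j hj
    · simp only [hj, if_false, abs_zero]; positivity
  · have hsum : cubeSlope φ e T = ∑ j ∈ T, (if j ∈ T then e else 0) • φ j :=
      Finset.sum_congr rfl fun j hj => by rw [if_pos hj]
    rw [hsum]
    exact hasSum_sum_of_ne_finset_zero fun j hj => by simp [hj]

/-- Bessel's inequality splits the risk into coordinate risks, and the combinatorial form of
Assouad's lemma applies to these: neighbouring vertices of the cube cannot be told apart when the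
`n`-fold product of their affinities is at least `1 / 2`. -/
lemma exists_card_mul_le_two_mul_risk (Q₀ : Measure ℝ) [IsProbabilityMeasure Q₀]
    (hQ : ∀ lam : ℝ, Integrable (fun y => Real.exp (lam * y)) Q₀) (ν : Measure L2I)
    [IsProbabilityMeasure ν] {φ : ℕ → L2I} (hφ : Orthonormal ℝ φ) (n : ℕ) (e : ℝ)
    (I : Finset ℕ) {Bhat : (Fin n → L2I × ℝ) → L2I} (hB : Measurable Bhat)
    (haff : ∀ T ⊆ I, ∀ T' ⊆ I, ∀ j ∈ I, (∀ k, k ≠ j → (k ∈ T ↔ k ∈ T')) →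
      ENNReal.ofReal (1 / 2) ≤ (∫⁻ p, sqrtDensity Q₀ (cubeSlope φ e T) p *
        sqrtDensity Q₀ (cubeSlope φ e T') p ∂(ν.prod Q₀)) ^ n) :
    ∃ T ⊆ I, I.card * ENNReal.ofReal (e ^ 2 / 16) ≤
      2 * risk Q₀ n ⟨0, ν, cubeSlope φ e T⟩ Bhat := by
  classical
  set V : Finset I → Finset ℕ := fun S => S.map (Function.Embedding.subtype _) with hV
  have hVI : ∀ S, V S ⊆ I := fun S k hk => by
    obtain ⟨i, -, rfl⟩ := Finset.mem_map.1 hk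
    exact i.2
  have hmemV : ∀ S (i : I), (i : ℕ) ∈ V S ↔ i ∈ S := fun S i => by simp [hV]
  set P : Finset I → Measure (Fin n → L2I × ℝ) :=
    fun S => obsLaw Q₀ n ⟨0, ν, cubeSlope φ e (V S)⟩ with hP
  set r : Finset I → I → ℝ≥0∞ := fun S i =>
    ∫⁻ d, ENNReal.ofReal ((⟪φ i, cubeSlope φ e (V S)⟫_ℝ - ⟪φ i, Bhat d⟫_ℝ) ^ 2) ∂(P S) with hr
  have hroot : ∀ B, Measurable fun d : Fin n → L2I × ℝ => ∏ i, sqrtDensity Q₀ B (d i) := fun B =>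
    Finset.measurable_prod _ fun i _ => (measurable_sqrtDensity hQ B).comp (measurable_pi_apply i)
  have hnorm : ∀ B, ∫⁻ d : Fin n → L2I × ℝ, (∏ i, sqrtDensity Q₀ B (d i)) ^ 2
      ∂(Measure.pi fun _ => ν.prod Q₀) = 1 := fun B => by
    simp_rw [← Finset.prod_pow]
    rw [lintegral_pi_prod (ν.prod Q₀) (f := fun _ p => sqrtDensity Q₀ B p ^ 2)
      fun _ => (measurable_sqrtDensity hQ B).pow_const 2]
    simp [lintegral_sqrtDensity_sq Q₀ hQ]
  have hpair : ∀ S (i : I), ENNReal.ofReal (e ^ 2 / 16) ≤ r S i + r (symmDiff {i} S) i := by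
    intro S i
    set u := cubeSlope φ e (V S) with hu
    set v := cubeSlope φ e (V (symmDiff {i} S)) with hv
    have hoff : ∀ k, k ≠ (i : ℕ) → (k ∈ V S ↔ k ∈ V (symmDiff {i} S)) := fun k hk => by
      by_cases hkI : k ∈ I
      · have hne : (⟨k, hkI⟩ : I) ≠ i := fun h => hk (congrArg Subtype.val h)
        rw [hmemV S ⟨k, hkI⟩, hmemV _ ⟨k, hkI⟩]
        simp [Finset.mem_symmDiff, hne]
      · exact iff_of_false (fun h => hkI (hVI _ h)) fun h => hkI (hVI _ h)
    have hsq : (⟪φ i, u⟫_ℝ - ⟪φ i, v⟫_ℝ) ^ 2 = e ^ 2 := by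
      rw [hu, hv, inner_cubeSlope hφ, inner_cubeSlope hφ]
      simp only [hmemV]
      by_cases hi : i ∈ S <;> simp [Finset.mem_symmDiff, hi]
    have hA := haff _ (hVI S) _ (hVI (symmDiff {i} S)) i i.2 hoff
    have hprod : ∫⁻ d : Fin n → L2I × ℝ, (∏ i, sqrtDensity Q₀ u (d i)) *
        ∏ i, sqrtDensity Q₀ v (d i) ∂(Measure.pi fun _ => ν.prod Q₀) =
        (∫⁻ p, sqrtDensity Q₀ u p * sqrtDensity Q₀ v p ∂(ν.prod Q₀)) ^ n := by
      simp_rw [← Finset.prod_mul_distrib]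
      rw [lintegral_pi_prod (ν.prod Q₀) (f := fun _ p => sqrtDensity Q₀ u p * sqrtDensity Q₀ v p)
        fun _ => (measurable_sqrtDensity hQ u).mul (measurable_sqrtDensity hQ v)]
      simp
    have hmin := sq_lintegral_mul_le_two_mul_lintegral_min (hroot u) (hroot v) (hnorm u).le
      (hnorm v).le
    rw [hprod] at hmin
    have htest := half_sq_mul_lintegral_min_le (μ := Measure.pi fun _ : Fin n => ν.prod Q₀)
      ((hroot u).pow_const 2) ((hroot v).pow_const 2)
      (h := fun d => ⟪φ i, Bhat d⟫_ℝ) (by fun_prop) ⟪φ i, u⟫_ℝ ⟪φ i, v⟫_ℝ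
    rw [hsq, ← obsLaw_eq_withDensity Q₀ hQ, ← obsLaw_eq_withDensity Q₀ hQ] at htest
    refine le_trans ?_ htest
    set m := ∫⁻ d : Fin n → L2I × ℝ, min ((∏ i, sqrtDensity Q₀ u (d i)) ^ 2)
      ((∏ i, sqrtDensity Q₀ v (d i)) ^ 2) ∂(Measure.pi fun _ => ν.prod Q₀)
    -- Le Cam's inequality turns an affinity of `1 / 2` into a testing affinity of `1 / 8`.
    have h14 : ENNReal.ofReal (1 / 4) ≤ 2 * m := by
      refine le_trans ?_ ((pow_le_pow_left₀ zero_le hA 2).trans hmin)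
      rw [← ENNReal.ofReal_pow (by norm_num)]
      norm_num
    calc ENNReal.ofReal (e ^ 2 / 16)
        = ENNReal.ofReal (e ^ 2 / 4) * ENNReal.ofReal (1 / 4) := by
          rw [← ENNReal.ofReal_mul (by positivity)]; ring_nf
      _ ≤ ENNReal.ofReal (e ^ 2 / 4) * (2 * m) := by gcongr
      _ = ENNReal.ofReal (e ^ 2 / 2) * m := by
          rw [← mul_assoc, ← ENNReal.ofReal_ofNat 2, ← ENNReal.ofReal_mul (by positivity)]
          ring_nf
  obtain ⟨S, hS⟩ := exists_card_mul_le_two_mul_sum r _ hpair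
  rw [Fintype.card_coe] at hS
  refine ⟨V S, hVI S, hS.trans ?_⟩
  gcongr
  rw [hr, risk, ← lintegral_finsetSum _ fun i _ => by fun_prop]
  refine lintegral_mono fun d => ?_
  have hbessel := hφ.sum_inner_products_le (s := I) (cubeSlope φ e (V S) - Bhat d)
  rw [← Finset.sum_coe_sort] at hbessel
  calc ∑ i : I, ENNReal.ofReal ((⟪φ i, cubeSlope φ e (V S)⟫_ℝ - ⟪φ i, Bhat d⟫_ℝ) ^ 2)
      = ENNReal.ofReal (∑ i : I, ‖⟪φ i, cubeSlope φ e (V S) - Bhat d⟫_ℝ‖ ^ 2) := by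
        rw [ENNReal.ofReal_sum_of_nonneg fun _ _ => by positivity]
        simp [inner_sub_right]
    _ ≤ ENNReal.ofReal (‖cubeSlope φ e (V S) - Bhat d‖ ^ 2) := ENNReal.ofReal_le_ofReal hbessel
    _ = ‖cubeSlope φ e (V S) - Bhat d‖ₑ ^ 2 := by
        rw [ENNReal.ofReal_pow (norm_nonneg _), ofReal_norm]

lemma half_le_pow_of_one_le_add {A : ℝ≥0∞} {n : ℕ} (hn : 1 ≤ n)
    (h : 1 ≤ A + ENNReal.ofReal (1 / (2 * n))) : ENNReal.ofReal (1 / 2) ≤ A ^ n := by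
  have hn' : (1 : ℝ) ≤ n := by exact_mod_cast hn
  have hle : (1 : ℝ) / (2 * n) ≤ 1 / 2 := by
    rw [div_le_div_iff₀ (by positivity) (by norm_num)]; linarith
  have hA : ENNReal.ofReal (1 - 1 / (2 * n)) ≤ A := by
    rw [ENNReal.ofReal_sub _ (by positivity), ENNReal.ofReal_one]
    exact tsub_le_iff_right.2 h
  refine le_trans ?_ (pow_le_pow_left₀ zero_le hA n)
  rw [← ENNReal.ofReal_pow (by linarith)]
  refine ENNReal.ofReal_le_ofReal ?_
  have hb := one_add_mul_le_pow (a := -(1 / (2 * n : ℝ))) (by linarith) n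
  have hmul : (n : ℝ) * -(1 / (2 * n)) = -(1 / 2) := by field_simp
  rw [hmul, ← sub_eq_add_neg, ← sub_eq_add_neg] at hb
  linarith

/-- Neighbouring vertices of the cube are hard to distinguish from `n` observations: the linear
predictors are so small that the probability of exceeding one is exponentially small in `1 / s`,
and the difference of two of them has second moment at most `t`. -/
lemma half_le_affinity_pow {Q₀ : Measure ℝ} {ν : Measure L2I} {K : ℝ → ℝ → ℝ}
    {θ : ℕ → ℝ} {φ : ℕ → L2I} (hK : HasSpectralDecomposition K θ φ)
    (hν : IsCentredGaussianLaw ν K) {C : ℝ} (hC0 : 0 ≤ C)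
    (hC : ∀ u v : L2I, 1 ≤ ∫⁻ p, sqrtDensity Q₀ u p * sqrtDensity Q₀ v p ∂(ν.prod Q₀) +
        (ν {x | 1 < |⟪u, x⟫_ℝ|} + (ν {x | 1 < |⟪v, x⟫_ℝ|} +
          ENNReal.ofReal (C * ∫ x, ⟪u - v, x⟫_ℝ ^ 2 ∂ν))))
    {n : ℕ} (hn : 1 ≤ n) {e s t : ℝ} (hs : 0 < s) {I : Finset ℕ}
    (ht : ∀ j ∈ I, θ j * e ^ 2 ≤ t) (ht0 : 0 ≤ t) (hst : I.card * t ≤ s)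
    (hsmall : 4 * Real.exp (-1 / (2 * s)) + C * t ≤ 1 / (2 * n))
    {T T' : Finset ℕ} (hT : T ⊆ I) (hT' : T' ⊆ I) {j : ℕ} (hj : j ∈ I)
    (hoff : ∀ k, k ≠ j → (k ∈ T ↔ k ∈ T')) :
    ENNReal.ofReal (1 / 2) ≤ (∫⁻ p, sqrtDensity Q₀ (cubeSlope φ e T) p *
        sqrtDensity Q₀ (cubeSlope φ e T') p ∂(ν.prod Q₀)) ^ n := by
  have hvar : ∀ T ⊆ I, ∫ x, ⟪cubeSlope φ e T, x⟫_ℝ ^ 2 ∂ν ≤ s := fun T hT => by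
    rw [hν.integral_inner_sq_eq_sum hK _ T fun k hk => by
      rw [inner_cubeSlope hK.orthonormal, if_neg hk]]
    calc ∑ k ∈ T, θ k * ⟪φ k, cubeSlope φ e T⟫_ℝ ^ 2 ≤ ∑ _k ∈ T, t := by
          refine Finset.sum_le_sum fun k hk => ?_
          rw [inner_cubeSlope hK.orthonormal, if_pos hk]
          exact ht k (hT hk)
      _ = T.card * t := by simp
      _ ≤ I.card * t := by gcongr
      _ ≤ s := hst
  have hdiff : ∫ x, ⟪cubeSlope φ e T - cubeSlope φ e T', x⟫_ℝ ^ 2 ∂ν ≤ t := by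
    rw [hν.integral_inner_sq_eq_sum hK _ {j} fun k hk => by
      rw [inner_sub_right, inner_cubeSlope hK.orthonormal, inner_cubeSlope hK.orthonormal]
      simp [hoff k (by simpa using hk)]]
    rw [Finset.sum_singleton, inner_sub_right, inner_cubeSlope hK.orthonormal,
      inner_cubeSlope hK.orthonormal]
    have hle := ht j hj
    by_cases h1 : j ∈ T <;> by_cases h2 : j ∈ T' <;> simp [h1, h2, ht0, hle]
  refine half_le_pow_of_one_le_add hn ((hC (cubeSlope φ e T) (cubeSlope φ e T')).trans ?_)
  gcongr
  calc ν {x | 1 < |⟪cubeSlope φ e T, x⟫_ℝ|} + (ν {x | 1 < |⟪cubeSlope φ e T', x⟫_ℝ|} +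
        ENNReal.ofReal (C * ∫ x, ⟪cubeSlope φ e T - cubeSlope φ e T', x⟫_ℝ ^ 2 ∂ν))
      ≤ ENNReal.ofReal (2 * Real.exp (-1 / (2 * s))) +
          (ENNReal.ofReal (2 * Real.exp (-1 / (2 * s))) + ENNReal.ofReal (C * t)) := by
        gcongr
        · exact hν.measure_one_lt_abs_inner_le _ hs (hvar T hT)
        · exact hν.measure_one_lt_abs_inner_le _ hs (hvar T' hT')
    _ = ENNReal.ofReal (4 * Real.exp (-1 / (2 * s)) + C * t) := by
        rw [← ENNReal.ofReal_add (by positivity) (by positivity),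
          ← ENNReal.ofReal_add (by positivity) (by positivity)]
        ring_nf
    _ ≤ ENNReal.ofReal (1 / (2 * n)) := ENNReal.ofReal_le_ofReal hsmall

/-! ### The choice of the cube -/

/-- The cube of slopes that yields the rate. It has `J` coordinates, with `J` of the order of
`n ^ (1 / (α + 2 * β))`, the smallest order for which a coefficient `e` of the largest size
allowed by the slope class gives `θ j * e ^ 2 ≲ 1 / n`. Here `t` bounds the second moment
of the difference of two neighbouring linear predictors and `s` that of a single one; `s` is of the order of `1 / J`, so the Gaussian
tail is negligible compared with `1 / n`. -/
lemma eventually_exists_cube {α β R : ℝ} (hα : 1 < α) (hβ : 1 / 2 < β) (hR : 0 < R) {θ : ℕ → ℝ}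
    (hθ : θ =O[atTop] fun j : ℕ => ((j : ℝ) + 1) ^ (-α)) {C : ℝ} (hC0 : 0 ≤ C) :
    ∃ c : ℝ, 0 < c ∧ ∀ᶠ n : ℕ in atTop, ∃ (e s t : ℝ) (I : Finset ℕ), 0 ≤ e ∧ 0 < s ∧ 0 ≤ t ∧
      (∀ j ∈ I, e ≤ R * ((j : ℝ) + 1) ^ (-β)) ∧ (∀ j ∈ I, θ j * e ^ 2 ≤ t) ∧ I.card * t ≤ s ∧
      4 * Real.exp (-1 / (2 * s)) + C * t ≤ 1 / (2 * n) ∧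
      2 * (c * rate α β n) ≤ I.card * (e ^ 2 / 16) := by
  obtain ⟨M, hM0, hM⟩ := hθ.exists_pos
  have hM := eventually_forall_ge_atTop.2 hM.bound
  set γ := α + 2 * β with hγ
  have hγ0 : 2 < γ := by linarith
  -- `δ` is so small that the quadratic part of the affinity loss is at most `1 / (4 * n)`.
  obtain ⟨δ, hδ0, hδR, hδ⟩ : ∃ δ : ℝ, 0 < δ ∧ δ ≤ R ∧ C * (δ ^ 2 * M) ≤ 1 / 4 := by
    have hW : 1 ≤ 1 + C * M := by nlinarith
    refine ⟨min R (1 / (2 * (1 + C * M))), by positivity, min_le_left _ _, ?_⟩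
    have h1 : min R (1 / (2 * (1 + C * M))) ≤ 1 / (2 * (1 + C * M)) := min_le_right _ _
    set W := 1 + C * M with hWdef
    calc C * (min R (1 / (2 * W)) ^ 2 * M) = (C * M) * min R (1 / (2 * W)) ^ 2 := by ring
      _ ≤ W * (1 / (2 * W)) ^ 2 := by gcongr; linarith
      _ = 1 / (4 * W) := by field_simp; norm_num
      _ ≤ 1 / 4 := by gcongr; linarith
  set D := δ ^ 2 * M with hD
  have hD0 : 0 < D := by positivity
  -- The block of indices is `[J, 2 * J)`, with `J` of the order of `n ^ (1 / γ)`.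
  set J : ℕ → ℕ := fun n => ⌈(n : ℝ) ^ (1 / γ)⌉₊ with hJ
  have hJtop : Tendsto J atTop atTop := tendsto_nat_ceil_atTop.comp
    ((tendsto_rpow_atTop (by positivity)).comp tendsto_natCast_atTop_atTop)
  have hexp : ∀ᶠ k : ℕ in atTop,
      (k : ℝ) ^ γ * Real.exp (-(1 / (2 * D)) * k) ≤ 1 / 16 :=
    ((tendsto_rpow_mul_exp_neg_mul_atTop_nhds_zero γ (1 / (2 * D)) (by positivity)).comp
      tendsto_natCast_atTop_atTop).eventually_le_const (by norm_num)
  refine ⟨δ ^ 2 * 2 ^ (1 - 4 * β) / 32, by positivity, ?_⟩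
  filter_upwards [eventually_ge_atTop 1, hJtop.eventually hM,
    hJtop.eventually hexp] with n hn hθn hexpn
  have hn' : (1 : ℝ) ≤ n := by exact_mod_cast hn
  have hroot1 : 1 ≤ (n : ℝ) ^ (1 / γ) := Real.one_le_rpow hn' (by positivity)
  have hJge : (n : ℝ) ^ (1 / γ) ≤ J n := Nat.le_ceil _
  have hJle : (J n : ℝ) ≤ 2 * (n : ℝ) ^ (1 / γ) := by
    linarith [Nat.ceil_lt_add_one (zero_le_one.trans hroot1)]
  set k : ℝ := (J n : ℝ) with hk
  have hk1 : 1 ≤ k := hroot1.trans hJge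
  have hnk : (n : ℝ) ≤ k ^ γ := by
    calc (n : ℝ) = ((n : ℝ) ^ (1 / γ)) ^ γ := by
          rw [← Real.rpow_mul (by positivity), one_div_mul_cancel (by positivity), Real.rpow_one]
      _ ≤ k ^ γ := by gcongr
  set e := δ * (2 * k) ^ (-β) with he
  have he0 : 0 ≤ e := by positivity
  have hesq : e ^ 2 = δ ^ 2 * (2 * k) ^ (-(2 * β)) := by
    rw [he, mul_pow, ← Real.rpow_natCast ((2 * k) ^ (-β)), ← Real.rpow_mul (by positivity)]
    push_cast; ring_nf
  set I := Finset.Ico (J n) (2 * J n) with hI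
  have hcard : (I.card : ℝ) = k := by
    rw [hI, Nat.card_Ico, hk]; congr 1; omega
  have ht : ∀ j ∈ I, θ j * e ^ 2 ≤ D * k ^ (-γ) := fun j hj => by
    have hjk : k ≤ (j : ℝ) + 1 := by
      have : (J n : ℝ) ≤ j := by exact_mod_cast (Finset.mem_Ico.1 hj).1
      linarith
    have hθj := hθn j (Finset.mem_Ico.1 hj).1
    rw [Real.norm_eq_abs, Real.norm_of_nonneg (by positivity)] at hθj
    calc θ j * e ^ 2 ≤ (M * ((j : ℝ) + 1) ^ (-α)) * e ^ 2 := by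
          gcongr; exact (le_abs_self _).trans hθj
      _ ≤ (M * k ^ (-α)) * (δ ^ 2 * k ^ (-(2 * β))) := by
          rw [hesq]
          have h1 : ((j : ℝ) + 1) ^ (-α) ≤ k ^ (-α) :=
            Real.rpow_le_rpow_of_nonpos (by positivity) hjk (by linarith)
          have h2 : (2 * k) ^ (-(2 * β)) ≤ k ^ (-(2 * β)) :=
            Real.rpow_le_rpow_of_nonpos (by positivity) (by linarith) (by linarith)
          gcongr
      _ = D * (k ^ (-α) * k ^ (-(2 * β))) := by rw [hD]; ring
      _ = D * k ^ (-γ) := by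
          rw [← Real.rpow_add (by positivity), hγ]; ring_nf
  -- `α > 1` and `β > 1 / 2` give `γ > 2`, so `J ^ (1 - γ) ≤ 1 / J`.
  have hst : (I.card : ℝ) * (D * k ^ (-γ)) ≤ D / k := by
    have h2 : k ^ (-γ) ≤ k ^ (-2 : ℝ) := Real.rpow_le_rpow_of_exponent_le hk1 (by linarith)
    rw [hcard]
    calc k * (D * k ^ (-γ)) ≤ k * (D * k ^ (-2 : ℝ)) := by gcongr
      _ = D / k := by
        rw [Real.rpow_neg (by positivity), Real.rpow_two]; field_simp
  have hsmall : 4 * Real.exp (-1 / (2 * (D / k))) + C * (D * k ^ (-γ)) ≤ 1 / (2 * n) := by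
    have h1 : Real.exp (-1 / (2 * (D / k))) ≤ 1 / (16 * n) := by
      rw [le_div_iff₀ (by positivity)]
      have hx : -1 / (2 * (D / k)) = -(1 / (2 * D)) * k := by field_simp
      rw [hx]
      have := mul_le_mul_of_nonneg_right hnk (Real.exp_pos (-(1 / (2 * D)) * k)).le
      linarith
    have h2 : k ^ (-γ) ≤ 1 / n := by
      rw [Real.rpow_neg (by positivity), ← one_div]; gcongr
    calc 4 * Real.exp (-1 / (2 * (D / k))) + C * (D * k ^ (-γ))
        ≤ 4 * (1 / (16 * n)) + C * D * (1 / n) := by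
          rw [← mul_assoc]; gcongr
      _ ≤ 4 * (1 / (16 * n)) + 1 / 4 * (1 / n) := by gcongr
      _ = 1 / (2 * n) := by field_simp; norm_num
  have hle : ∀ j ∈ I, e ≤ R * ((j : ℝ) + 1) ^ (-β) := fun j hj => by
    have hjk : (j : ℝ) + 1 ≤ 2 * k := by
      rw [hk]; exact_mod_cast (Finset.mem_Ico.1 hj).2
    have h1 : (2 * k) ^ (-β) ≤ ((j : ℝ) + 1) ^ (-β) :=
      Real.rpow_le_rpow_of_nonpos (by positivity) hjk (by linarith)
    rw [he]; gcongr
  have hrate : 2 * (δ ^ 2 * 2 ^ (1 - 4 * β) / 32 * rate α β n) ≤ I.card * (e ^ 2 / 16) := by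
    have h1 : (2 * (n : ℝ) ^ (1 / γ)) ^ (1 - 2 * β) ≤ k ^ (1 - 2 * β) :=
      Real.rpow_le_rpow_of_nonpos (by positivity) hJle (by linarith)
    have h2 : (2 * (n : ℝ) ^ (1 / γ)) ^ (1 - 2 * β) = 2 ^ (1 - 2 * β) * rate α β n := by
      rw [Real.mul_rpow (by norm_num) (by positivity), ← Real.rpow_mul (by positivity), rate,
        one_div_mul_eq_div]
    have h3 : (2 : ℝ) ^ (1 - 4 * β) = 2 ^ (1 - 2 * β) * 2 ^ (-(2 * β)) := by
      rw [← Real.rpow_add (by norm_num)]; ring_nf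
    have h4 : k * k ^ (-(2 * β)) = k ^ (1 - 2 * β) := by
      rw [sub_eq_add_neg, Real.rpow_add (by positivity), Real.rpow_one]
    rw [hcard]
    calc 2 * (δ ^ 2 * 2 ^ (1 - 4 * β) / 32 * rate α β n)
        = δ ^ 2 / 16 * 2 ^ (-(2 * β)) * (2 ^ (1 - 2 * β) * rate α β n) := by rw [h3]; ring
      _ ≤ δ ^ 2 / 16 * 2 ^ (-(2 * β)) * k ^ (1 - 2 * β) := by rw [← h2]; gcongr
      _ = k * (e ^ 2 / 16) := by
          rw [hesq, Real.mul_rpow (by norm_num) (by positivity), ← h4]; ring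
  exact ⟨e, D / k, D * k ^ (-γ), I, he0, by positivity, by positivity, hle, ht, hst, hsmall, hrate⟩

end FunctionalGLM

open FunctionalGLM in
theorem mainTheorem1
    -- the exponential family: all exponential moments of `Q₀` are finite
    (Q₀ : Measure ℝ) [IsProbabilityMeasure Q₀]
    (hQ₀ : ∀ lam : ℝ, Integrable (fun y => Real.exp (lam * y)) Q₀)
    (α β R : ℝ) (hα : 1 < α) (hβ : 1 / 2 < β) (hR : 0 < R)
    -- the fixed covariance kernel, its spectral decomposition, and the Gaussian covariate law
    (K : ℝ → ℝ → ℝ) (θ : ℕ → ℝ) (φ : ℕ → FunctionalGLM.L2I)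
    (hK : FunctionalGLM.HasSpectralDecomposition K θ φ)
    (hθ : θ =Θ[atTop] fun j : ℕ => ((j : ℝ) + 1) ^ (-α))
    (ν : Measure FunctionalGLM.L2I) (hν : FunctionalGLM.IsCentredGaussianLaw ν K) :
    ∃ c : ℝ, 0 < c ∧ ∀ᶠ n : ℕ in atTop,
      ∀ 𝓕 : Set FunctionalGLM.Param, FunctionalGLM.subProblem ν φ R β ⊆ 𝓕 →
      ∀ Bhat : (Fin n → FunctionalGLM.L2I × ℝ) → FunctionalGLM.L2I, Measurable Bhat →
        ENNReal.ofReal (c * FunctionalGLM.rate α β n) ≤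
          ⨆ f ∈ 𝓕, FunctionalGLM.risk Q₀ n f Bhat := by
  have := hν.isGaussian
  obtain ⟨C, hC0, hC⟩ := exists_one_le_affinity_add Q₀ hQ₀ ν
  obtain ⟨c, hc, hcube⟩ := eventually_exists_cube hα hβ hR hθ.1 hC0
  refine ⟨c, hc, ?_⟩
  filter_upwards [eventually_ge_atTop 1, hcube] with n hn hcube_n 𝓕 h𝓕 Bhat hB
  obtain ⟨e, s, t, I, he0, hs0, ht0, hle, ht, hst, hsmall, hrate⟩ := hcube_n
  obtain ⟨T, hTI, hT⟩ := exists_card_mul_le_two_mul_risk Q₀ hQ₀ ν hK.orthonormal n e I hB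
    fun T hT T' hT' j hj hoff =>
      half_le_affinity_pow hK hν hC0 hC hn hs0 ht ht0 hst hsmall hT hT' hj hoff
  have hmem : (⟨0, ν, cubeSlope φ e T⟩ : Param) ∈ subProblem ν φ R β :=
    ⟨rfl, rfl, cubeSlope_mem_slopeClass φ hR.le he0 T fun j hj => hle j (hTI hj)⟩
  refine le_trans ?_ (le_iSup₂_of_le (⟨0, ν, cubeSlope φ e T⟩ : Param) (h𝓕 hmem) le_rfl)
  have hfin : 2 * ENNReal.ofReal (c * rate α β n) ≤
      2 * risk Q₀ n ⟨0, ν, cubeSlope φ e T⟩ Bhat := by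
    refine le_trans ?_ hT
    rw [← ENNReal.ofReal_ofNat 2, ← ENNReal.ofReal_mul (by norm_num), ← ENNReal.ofReal_natCast,
      ← ENNReal.ofReal_mul (by positivity)]
    exact ENNReal.ofReal_le_ofReal hrate
  exact (ENNReal.mul_le_mul_iff_right two_ne_zero ENNReal.ofNat_ne_top).1 hfin
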